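/- For an integrable function $f:(0,1)\to\mathbb{R}$ and a bounded nonempty open interval $Q\subset(0,1)$ put $\mathrm{Osc}(f,Q)=\frac1{|Q|}\int_Q\bigl|f(x)-\frac1{|Q|}\int_Q f\bigr|\,dx$, and for $\varepsilon>0$ let $$\mathsf K_\varepsilon(f)=\sup_{\mathcal H_\varepsilon}\ \sum_{Q\in\mathcal H_\varepsilon}\mathrm{Osc}(f,Q),$$ where the supremum is over all families $\mathcal H_\varepsilon$ of pairwise disjoint open intervals of length $\varepsilon$ contained in $(0,1)$. Let $|Df|((0,1))=\sup\{\int_0^1 f\varphi'\,dx:\varphi\in C^1_c((0,1)),\ \|\varphi\|_\infty\le1\}$, and let $BV(0,1)$ be the set of $f\in L^1(0,1)$ with $|Df|((0,1))<\infty$; for such $f$ the distributional derivative $Df$ is a finite signed Borel measure on $(0,1)$. Call $f\in BV(0,1)$ purely Cantorian if $Df$ is singular with respect to Lebesgue measure and has no atoms. Then there exists a purely Cantorian function $u\in BV(0,1)$, non-decreasing on $(0,1)$, with $|Du|((0,1))=1$, such that $$\liminf_{\varepsilon\to0^+}\mathsf K_\varepsilon(u)=\frac14\qquad\text{and}\qquad\limsup_{\varepsilon\to0^+}\mathsf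 K_\varepsilon(u)=\frac12 .$$ In particular, $\lim_{\varepsilon\to0^+}\mathsf K_\varepsilon(u)$ does not exist. -/

import Mathlib

open MeasureTheory Set Filter Topology
open scoped ENNReal

namespace OneDimBV

noncomputable section

/-- Mean oscillation `Osc(f, Q) = ⨍_Q |f - ⨍_Q f|` with respect to Lebesgue measure. -/
def osc (f : ℝ → ℝ) (Q : Set ℝ) : ℝ :=
  ⨍ x in Q, |f x - ⨍ y in Q, f y|

/-- `IsCubeFamily Ω ε A`: the open intervals `(a, a + ε)`, `a ∈ A`, form a family of pairwise
disjoint one-dimensional open cubes of sidelength `ε` contained in `Ω`. -/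
def IsCubeFamily (Ω : Set ℝ) (ε : ℝ) (A : Set ℝ) : Prop :=
  (∀ a ∈ A, Ioo a (a + ε) ⊆ Ω) ∧ A.PairwiseDisjoint (fun a => Ioo a (a + ε))

/-- The functional `K_ε(f)` on an open set `Ω ⊆ ℝ`: the supremum, over all families of pairwise
disjoint open intervals of length `ε` contained in `Ω`, of the sum of the mean oscillations of `f`.
(The factor `ε ^ (n - 1)` is `1` in dimension `n = 1`.) -/
def K (ε : ℝ) (f : ℝ → ℝ) (Ω : Set ℝ) : ℝ≥0∞ :=
  ⨆ (A : Set ℝ) (_ : IsCubeFamily Ω ε A), ∑' a : A, ENNReal.ofReal (osc f (Ioo a.1 (a.1 + ε)))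

/-- `φ ∈ C¹_c(Ω)`. -/
def IsTest (Ω : Set ℝ) (φ : ℝ → ℝ) : Prop :=
  ContDiff ℝ 1 φ ∧ HasCompactSupport φ ∧ tsupport φ ⊆ Ω

/-- The total variation `|Df|(Ω) = sup {∫_Ω f φ' : φ ∈ C¹_c(Ω), ‖φ‖_∞ ≤ 1}`. -/
def totalVar (f : ℝ → ℝ) (Ω : Set ℝ) : ℝ≥0∞ :=
  ⨆ (φ : ℝ → ℝ) (_ : IsTest Ω φ ∧ ∀ x, |φ x| ≤ 1), ENNReal.ofReal (∫ x in Ω, f x * deriv φ x)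

/-- `f ∈ BV(Ω)`: `f` is integrable on `Ω` and has finite total variation there. -/
def IsBV (f : ℝ → ℝ) (Ω : Set ℝ) : Prop :=
  IntegrableOn f Ω ∧ totalVar f Ω < ∞

/-- The integral of `φ` against a finite signed measure. -/
def signedIntegral (μ : SignedMeasure ℝ) (φ : ℝ → ℝ) : ℝ :=
  ∫ x, φ x ∂μ.toJordanDecomposition.posPart - ∫ x, φ x ∂μ.toJordanDecomposition.negPart

/-- The finite signed measure `μ`, concentrated on `Ω`, is the distributional derivative `Df` of
`f` in `Ω`. For `f ∈ BV(Ω)`, `Ω` open, there is exactly one such `μ`. -/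
def IsDistribDeriv (f : ℝ → ℝ) (Ω : Set ℝ) (μ : SignedMeasure ℝ) : Prop :=
  (∀ s, MeasurableSet s → Disjoint s Ω → μ s = 0) ∧
    ∀ φ, IsTest Ω φ → ∫ x in Ω, f x * deriv φ x = -signedIntegral μ φ

/-- `f` is purely Cantorian in `Ω`, that is `Df = Dᶜf`: the absolutely continuous part of `Df`
vanishes (`Df` is singular with respect to Lebesgue measure) and so does its jump part, which in
dimension one is the atomic part of `Df`. -/
def IsPurelyCantorian (f : ℝ → ℝ) (Ω : Set ℝ) : Prop :=
  ∃ μ : SignedMeasure ℝ, IsDistribDeriv f Ω μ ∧ μ.totalVariation ⟂ₘ volume ∧ ∀ x, μ {x} = 0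

end

end OneDimBV

namespace OneDimBV

/-! For a continuous monotone `u` rising from 0 to 1, every small-scale limit value of `K` lies in
[1/4, 1/2]. The oscillation on an interval is at most half the increment (`osc_le_half`), with near
equality when the increment is concentrated near the midpoint; it is a quarter of the increment when
`u` is affine. No `u` does worse than affine: the grid of step `ε` and its shift by `ε / 2` together
see half of the variation, so one of them sees a quarter (`quarter_le_K`).

A Cantor-type function can look affine at some scales and concentrated at others. Start from the
identity ramp. The `n`-th staircase has slope `s = slope n` and `s ^ 2` rise intervals of length `1
/ s ^ 3`. To pass to the next one, cut each rise into `(n + 2) ^ 2` equal cells and let the function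
rise only on the central proportion `1 / (n + 2)` of each cell. At scale `1 / (s ^ 3 * (n + 2) ^
2)`, one cell, the increments are concentrated and `K` is near 1/2 (`le_K_cantorLimit`). The scale
`1 / (s ^ 3 * (n + 2))` is much longer than a cell and much shorter than a rise, so the limit is
nearly affine there and `K` is near 1/4 (`K_cantorLimit_le`).

The limit is continuous, so its derivative has no atoms. It is constant off rise sets of measure at
most `1 / slope n`, so its derivative is singular. -/

/-! ### Mean oscillation of monotone functions on one interval -/

lemma osc_Ioo (f : ℝ → ℝ) {a b : ℝ} (hab : a < b) :
    osc f (Ioo a b) =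
      (b - a)⁻¹ * ∫ x in a..b, |f x - (b - a)⁻¹ * ∫ y in a..b, f y| := by
  have hv : (volume : Measure ℝ).real (Ioo a b) = b - a := by
    rw [measureReal_def, Real.volume_Ioo, ENNReal.toReal_ofReal (by linarith)]
  simp only [osc, setAverage_eq, hv, smul_eq_mul, intervalIntegral.integral_of_le hab.le,
    integral_Ioc_eq_integral_Ioo]

lemma mean_mem_Icc {f : ℝ → ℝ} (hf : Monotone f) {a b : ℝ} (hab : a < b) :
    (b - a)⁻¹ * ∫ y in a..b, f y ∈ Icc (f a) (f b) := by
  have hba : 0 < b - a := by linarith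
  have hi : IntervalIntegrable f volume a b := hf.intervalIntegrable
  have h1 : ∫ _ in a..b, f a ≤ ∫ y in a..b, f y :=
    intervalIntegral.integral_mono_on hab.le (by simp) hi fun x hx => hf hx.1
  have h2 : ∫ y in a..b, f y ≤ ∫ _ in a..b, f b :=
    intervalIntegral.integral_mono_on hab.le hi (by simp) fun x hx => hf hx.2
  rw [intervalIntegral.integral_const, smul_eq_mul] at h1 h2
  exact ⟨(le_inv_mul_iff₀ hba).2 h1, (inv_mul_le_iff₀ hba).2 h2⟩

/-- The mean oscillation of a monotone function is at most half of its increment. -/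
lemma osc_le_half {f : ℝ → ℝ} (hf : Monotone f) {a b : ℝ} (hab : a < b) :
    osc f (Ioo a b) ≤ (f b - f a) / 2 := by
  rw [osc_Ioo f hab]
  set m := (b - a)⁻¹ * ∫ y in a..b, f y with hm
  have hba : 0 < b - a := by linarith
  have hi : IntervalIntegrable f volume a b := hf.intervalIntegrable
  have hint : ∫ y in a..b, f y = (b - a) * m := by rw [hm]; field_simp
  obtain ⟨hm1, hm2⟩ : m ∈ Icc (f a) (f b) := mean_mem_Icc hf hab
  have hi2 : IntervalIntegrable (fun x => |f x - m|) volume a b := (hi.sub (by simp)).abs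
  -- By convexity `|y - m|` lies below its chord over `[f a, f b]`; the chord is affine in `y`, so
  -- its mean depends only on `m`. Both sides are multiplied by `f b - f a` to avoid a division.
  have key : (f b - f a) * ∫ x in a..b, |f x - m| ≤ (b - a) * (2 * ((f b - m) * (m - f a))) := by
    rw [← intervalIntegral.integral_const_mul]
    have h1 : ∫ x in a..b, (f b - f a) * |f x - m| ≤
        ∫ x in a..b, ((f b * (m - f a) - f a * (f b - m)) + ((f b - m) - (m - f a)) * f x) := by
      refine intervalIntegral.integral_mono_on hab.le (hi2.const_mul _)
        ((by simp : IntervalIntegrable _ _ _ _).add (hi.const_mul _)) fun x hx => ?_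
      have h1 := hf hx.1
      have h2 := hf hx.2
      rcases abs_cases (f x - m) with ⟨h, h'⟩ | ⟨h, h'⟩ <;> rw [h] <;> nlinarith
    rw [intervalIntegral.integral_add (by simp) (hi.const_mul _),
      intervalIntegral.integral_const_mul _ f, hint, intervalIntegral.integral_const,
      smul_eq_mul] at h1
    linarith
  rcases (hf hab.le).eq_or_lt with h | h
  · have h0 : ∫ x in a..b, |f x - m| ≤ ∫ x in a..b, 0 := by
      refine intervalIntegral.integral_mono_on hab.le hi2 (by simp) fun x hx => ?_
      have h1 := hf hx.1
      have h2 := hf hx.2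
      rw [abs_nonpos_iff]; linarith
    rw [intervalIntegral.integral_zero] at h0
    have : (b - a)⁻¹ * ∫ x in a..b, |f x - m| ≤ 0 :=
      mul_nonpos_of_nonneg_of_nonpos (by positivity) h0
    linarith
  · rw [inv_mul_le_iff₀ hba]
    refine le_of_mul_le_mul_left (key.trans ?_) (sub_pos.2 h)
    -- AM-GM: `4 * (f b - m) * (m - f a) ≤ (f b - f a) ^ 2`.
    nlinarith [mul_nonneg hba.le (sq_nonneg ((f b - m) - (m - f a)))]

/-- The mean oscillation of a monotone `Λ`-Lipschitz function is at most that of an affine function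
of slope `Λ`. -/
lemma osc_le_of_lipschitz {f : ℝ → ℝ} (hf : Monotone f) (hc : Continuous f) {Λ : ℝ}
    (hL : ∀ x y, x ≤ y → f y - f x ≤ Λ * (y - x)) {a b : ℝ} (hab : a < b) :
    osc f (Ioo a b) ≤ Λ * (b - a) / 4 := by
  have hΛ : 0 ≤ Λ := by
    have h1 := hL 0 1 zero_le_one
    have h2 := hf (zero_le_one (α := ℝ))
    linarith
  rw [osc_Ioo f hab]
  set m := (b - a)⁻¹ * ∫ y in a..b, f y with hm
  have hba : 0 < b - a := by linarith
  have hi : ∀ a b, IntervalIntegrable f volume a b := fun _ _ => hf.intervalIntegrable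
  have hint : ∫ y in a..b, f y = (b - a) * m := by rw [hm]; field_simp
  -- Cut where `f` takes its mean value. The deviations on the two sides have equal integrals, so
  -- the total is twice the smaller one, and the shorter side has length at most `(b - a) / 2`.
  obtain ⟨c, hcab, hcm⟩ := intermediate_value_Icc hab.le hc.continuousOn (mean_mem_Icc hf hab)
  have hi2 : ∀ a b, IntervalIntegrable (fun x => |f x - m|) volume a b :=
    fun _ _ => ((hi _ _).sub (by simp)).abs
  rw [← intervalIntegral.integral_add_adjacent_intervals (hi2 a c) (hi2 c b)]
  have e1 : ∫ x in a..c, |f x - m| = ∫ x in a..c, (m - f x) := by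
    refine intervalIntegral.integral_congr fun x hx => ?_
    rw [uIcc_of_le hcab.1] at hx
    have := hf hx.2
    change |f x - m| = m - f x
    rw [abs_of_nonpos (by linarith)]; ring
  have e2 : ∫ x in c..b, |f x - m| = ∫ x in c..b, (f x - m) := by
    refine intervalIntegral.integral_congr fun x hx => ?_
    rw [uIcc_of_le hcab.2] at hx
    have := hf hx.1
    change |f x - m| = f x - m
    rw [abs_of_nonneg (by linarith)]
  have b1 : ∫ x in a..c, (m - f x) ≤ Λ * (c - a) ^ 2 / 2 := by
    have : ∫ x in a..c, (m - f x) ≤ ∫ x in a..c, (Λ * c - Λ * x) := by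
      refine intervalIntegral.integral_mono_on hcab.1 ((by simp : IntervalIntegrable _ _ _ _).sub
        (hi _ _)) (Continuous.intervalIntegrable (by fun_prop) _ _) fun x hx => ?_
      have := hL x c hx.2
      linarith
    refine this.trans (le_of_eq ?_)
    rw [intervalIntegral.integral_sub (by simp) (Continuous.intervalIntegrable (by fun_prop) _ _),
      intervalIntegral.integral_const_mul _ (fun x => x), integral_id,
      intervalIntegral.integral_const, smul_eq_mul]
    ring
  have b2 : ∫ x in c..b, (f x - m) ≤ Λ * (b - c) ^ 2 / 2 := by
    have : ∫ x in c..b, (f x - m) ≤ ∫ x in c..b, (Λ * x - Λ * c) := by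
      refine intervalIntegral.integral_mono_on hcab.2 ((hi _ _).sub (by simp))
        (Continuous.intervalIntegrable (by fun_prop) _ _) fun x hx => ?_
      have := hL c x hx.1
      linarith
    refine this.trans (le_of_eq ?_)
    rw [intervalIntegral.integral_sub (Continuous.intervalIntegrable (by fun_prop) _ _) (by simp),
      intervalIntegral.integral_const_mul _ (fun x => x), integral_id,
      intervalIntegral.integral_const, smul_eq_mul]
    ring
  have eq : ∫ x in a..c, (m - f x) = ∫ x in c..b, (f x - m) := by
    have h := intervalIntegral.integral_add_adjacent_intervals (hi a c) (hi c b)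
    rw [intervalIntegral.integral_sub (by simp) (hi _ _),
      intervalIntegral.integral_sub (hi _ _) (by simp), intervalIntegral.integral_const,
      intervalIntegral.integral_const, smul_eq_mul, smul_eq_mul]
    linarith
  rw [e1, e2, inv_mul_le_iff₀ hba]
  obtain ⟨h1, h2⟩ := hcab
  rcases le_total (c - a) (b - c) with h | h
  · have : Λ * (c - a) ^ 2 ≤ Λ * ((b - a) / 2) ^ 2 := by
      gcongr
      linarith
    nlinarith
  · have : Λ * (b - c) ^ 2 ≤ Λ * ((b - a) / 2) ^ 2 := by
      gcongr
      linarith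
    nlinarith

/-- One `δ` comes from the pointwise difference, the other from the difference of the means. -/
lemma osc_le_osc_add {f g : ℝ → ℝ} (hf : Monotone f) (hg : Monotone g) {δ : ℝ}
    (hd : ∀ x, |f x - g x| ≤ δ) {a b : ℝ} (hab : a < b) :
    osc f (Ioo a b) ≤ osc g (Ioo a b) + 2 * δ := by
  rw [osc_Ioo f hab, osc_Ioo g hab]
  have hba : 0 < b - a := by linarith
  have hif : IntervalIntegrable f volume a b := hf.intervalIntegrable
  have hig : IntervalIntegrable g volume a b := hg.intervalIntegrable
  set m := (b - a)⁻¹ * ∫ y in a..b, f y with hm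
  set n := (b - a)⁻¹ * ∫ y in a..b, g y with hn
  have hmn : |m - n| ≤ δ := by
    rw [hm, hn, ← mul_sub, ← intervalIntegral.integral_sub hif hig, abs_mul,
      abs_of_pos (inv_pos.2 hba), inv_mul_le_iff₀ hba]
    have := intervalIntegral.norm_integral_le_of_norm_le_const (a := a) (b := b)
      (f := fun x => f x - g x) (C := δ) fun x _ => hd x
    rw [abs_of_pos hba] at this
    rw [Real.norm_eq_abs] at this
    linarith
  rw [inv_mul_le_iff₀ hba, mul_add, mul_inv_cancel_left₀ hba.ne']
  have : ∫ x in a..b, |f x - m| ≤ ∫ x in a..b, (|g x - n| + 2 * δ) := by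
    refine intervalIntegral.integral_mono_on hab.le (hif.sub (by simp)).abs
      ((hig.sub (by simp)).abs.add (by simp)) fun x _ => ?_
    have h1 := abs_add_three (f x - g x) (g x - n) (n - m)
    have h2 := hd x
    rw [abs_sub_comm] at hmn
    rw [show f x - g x + (g x - n) + (n - m) = f x - m by ring] at h1
    linarith
  rw [intervalIntegral.integral_add (hig.sub (by simp)).abs (by simp),
    intervalIntegral.integral_const, smul_eq_mul] at this
  exact this

/-- Lower bound for the mean oscillation by comparing the two ends of the interval. -/
lemma le_osc {f : ℝ → ℝ} (hf : Monotone f) {a b h : ℝ} (hab : a < b) (h0 : 0 ≤ h)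
    (hh : 2 * h ≤ b - a) :
    (b - a)⁻¹ * ((∫ x in (b - h)..b, f x) - ∫ x in a..(a + h), f x) ≤ osc f (Ioo a b) := by
  rw [osc_Ioo f hab]
  have hba : 0 < b - a := by linarith
  gcongr
  set m := (b - a)⁻¹ * ∫ y in a..b, f y with hm
  have hi : ∀ a b, IntervalIntegrable f volume a b := fun _ _ => hf.intervalIntegrable
  have hi2 : ∀ a b, IntervalIntegrable (fun x => |f x - m|) volume a b :=
    fun _ _ => ((hi _ _).sub (by simp)).abs
  -- Drop the middle and use `m - f` on the left end and `f - m` on the right end; the ends have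
  -- equal length, so `m` cancels.
  rw [← intervalIntegral.integral_add_adjacent_intervals (hi2 a (a + h)) (hi2 (a + h) b),
    ← intervalIntegral.integral_add_adjacent_intervals (hi2 (a + h) (b - h)) (hi2 (b - h) b)]
  have h1 : 0 ≤ ∫ x in (a + h)..(b - h), |f x - m| :=
    intervalIntegral.integral_nonneg (by linarith) fun x _ => abs_nonneg _
  have h2 : ∫ x in a..(a + h), (m - f x) ≤ ∫ x in a..(a + h), |f x - m| :=
    intervalIntegral.integral_mono_on (by linarith) ((by simp : IntervalIntegrable _ _ _ _).sub
      (hi _ _)) (hi2 _ _) fun x _ => by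
        rw [abs_sub_comm]; exact le_abs_self _
  have h3 : ∫ x in (b - h)..b, (f x - m) ≤ ∫ x in (b - h)..b, |f x - m| :=
    intervalIntegral.integral_mono_on (by linarith) ((hi _ _).sub (by simp)) (hi2 _ _)
      fun x _ => le_abs_self _
  rw [intervalIntegral.integral_sub (by simp) (hi _ _), intervalIntegral.integral_const,
    smul_eq_mul] at h2
  rw [intervalIntegral.integral_sub (hi _ _) (by simp), intervalIntegral.integral_const,
    smul_eq_mul] at h3
  linarith

lemma le_osc_of_ends {f : ℝ → ℝ} (hf : Monotone f) {a b h : ℝ} (hab : a < b) (h0 : 0 ≤ h)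
    (hh : 2 * h ≤ b - a) :
    (b - a)⁻¹ * (h * (f (b - h) - f (a + h))) ≤ osc f (Ioo a b) := by
  refine le_trans ?_ (le_osc hf hab h0 hh)
  have hba : 0 < b - a := by linarith
  gcongr
  have hi : ∀ a b, IntervalIntegrable f volume a b := fun _ _ => hf.intervalIntegrable
  have h1 : ∫ x in (b - h)..b, f (b - h) ≤ ∫ x in (b - h)..b, f x :=
    intervalIntegral.integral_mono_on (by linarith) (by simp) (hi _ _) fun x hx => hf hx.1
  have h2 : ∫ x in a..(a + h), f x ≤ ∫ x in a..(a + h), f (a + h) :=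
    intervalIntegral.integral_mono_on (by linarith) (hi _ _) (by simp) fun x hx => hf hx.2
  rw [intervalIntegral.integral_const, smul_eq_mul] at h1 h2
  linarith

/-! ### Bounds for `K` for monotone functions -/

/-- Countable additivity turns a bound on single intervals into one on all disjoint families. It
serves with half the Stieltjes measure and with a multiple of Lebesgue measure near the rises. -/
lemma K_le_measure {f : ℝ → ℝ} {Ω : Set ℝ} {ε : ℝ} (ν : Measure ℝ)
    (h : ∀ a, Ioo a (a + ε) ⊆ Ω → ENNReal.ofReal (osc f (Ioo a (a + ε))) ≤ ν (Ioo a (a + ε))) :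
    K ε f Ω ≤ ν Ω := by
  refine iSup₂_le fun A hA => ?_
  calc ∑' a : A, ENNReal.ofReal (osc f (Ioo a.1 (a.1 + ε)))
      ≤ ∑' a : A, ν (Ioo a.1 (a.1 + ε)) := ENNReal.tsum_le_tsum fun a => h a (hA.1 a a.2)
    _ ≤ ν (⋃ a : A, Ioo a.1 (a.1 + ε)) :=
        tsum_meas_le_meas_iUnion_of_disjoint ν (fun _ => measurableSet_Ioo) fun a b hab =>
          hA.2 a.2 b.2 fun h => hab (Subtype.ext h)
    _ ≤ ν Ω := measure_mono (iUnion_subset fun a => hA.1 a a.2)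

lemma le_K {f : ℝ → ℝ} {Ω : Set ℝ} {ε : ℝ} (hε : 0 < ε) (t : Finset ℕ) (a c : ℕ → ℝ)
    (hsub : ∀ i ∈ t, Ioo (a i) (a i + ε) ⊆ Ω)
    (hsep : ∀ i ∈ t, ∀ j ∈ t, i < j → a i + ε ≤ a j)
    (hc : ∀ i ∈ t, c i ≤ osc f (Ioo (a i) (a i + ε))) :
    ENNReal.ofReal (∑ i ∈ t, c i) ≤ K ε f Ω := by
  have hinj : Set.InjOn a t := by
    intro i hi j hj hij
    by_contra hne
    rcases lt_or_gt_of_ne hne with h | h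
    · have := hsep i hi j hj h; linarith
    · have := hsep j hj i hi h; linarith
  have hfam : IsCubeFamily Ω ε (↑(t.image a) : Set ℝ) := by
    constructor
    · intro x hx
      obtain ⟨i, hi, rfl⟩ := Finset.mem_image.1 hx
      exact hsub i hi
    · intro x hx y hy hxy
      obtain ⟨i, hi, rfl⟩ := Finset.mem_image.1 hx
      obtain ⟨j, hj, rfl⟩ := Finset.mem_image.1 hy
      refine Set.disjoint_left.2 fun z hz hz' => ?_
      have hne : i ≠ j := fun h => hxy (by rw [h])
      rcases lt_or_gt_of_ne hne with h | h
      · have := hsep i hi j hj h; linarith [hz.2, hz'.1]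
      · have := hsep j hj i hi h; linarith [hz'.2, hz.1]
  refine le_trans ?_ (le_iSup₂ (f := fun (A : Set ℝ) (_ : IsCubeFamily Ω ε A) =>
    ∑' a : A, ENNReal.ofReal (osc f (Ioo a.1 (a.1 + ε)))) _ hfam)
  rw [Finset.tsum_subtype' (t.image a) fun x => ENNReal.ofReal (osc f (Ioo x (x + ε))),
    Finset.sum_image hinj]
  calc ENNReal.ofReal (∑ i ∈ t, c i)
      ≤ ENNReal.ofReal (∑ i ∈ t, max (c i) 0) :=
        ENNReal.ofReal_le_ofReal (Finset.sum_le_sum fun i _ => le_max_left _ _)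
    _ = ∑ i ∈ t, ENNReal.ofReal (max (c i) 0) :=
        ENNReal.ofReal_sum_of_nonneg fun i _ => le_max_right _ _
    _ ≤ _ := Finset.sum_le_sum fun i hi => by
        rw [ENNReal.ofReal_max, ENNReal.ofReal_zero, max_eq_left (zero_le)]
        exact ENNReal.ofReal_le_ofReal (hc i hi)

lemma K_le_half {f : ℝ → ℝ} (hf : Monotone f) (μ : Measure ℝ)
    (hμ : ∀ a b, μ (Ioo a b) = ENNReal.ofReal (f b - f a)) (hμ1 : μ univ ≤ 1)
    (Ω : Set ℝ) {ε : ℝ} (hε : 0 < ε) : K ε f Ω ≤ 1 / 2 := by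
  refine (K_le_measure ((1 / 2 : ℝ≥0∞) • μ) fun a _ => ?_).trans ?_
  · rw [Measure.smul_apply, hμ, smul_eq_mul]
    refine (ENNReal.ofReal_le_ofReal (osc_le_half hf (by linarith : a < a + ε))).trans ?_
    rw [div_eq_inv_mul, ENNReal.ofReal_mul (by norm_num), ENNReal.ofReal_inv_of_pos two_pos]
    simp
  · rw [Measure.smul_apply, smul_eq_mul]
    calc (1 / 2 : ℝ≥0∞) * μ Ω ≤ 1 / 2 * 1 := by
          gcongr
          exact (measure_mono (subset_univ _)).trans hμ1
      _ = 1 / 2 := mul_one _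

/-- Of the two grids of step `ε` shifted by `ε / 2` one sees a quarter of the variation. -/
lemma quarter_le_K {f : ℝ → ℝ} (hf : Monotone f) {ε : ℝ} (hε : 0 < ε) (hε2 : ε < 1 / 2) :
    ENNReal.ofReal ((f (1 - ε) - f ε) / 4) ≤ K ε f (Ioo 0 1) := by
  set h := ε / 2 with hh
  have hpos : 0 < h := by positivity
  -- The half-cells numbered 0 to `N` fit in `[0, 1]`, and the last one starts beyond `1 - ε`.
  obtain ⟨N, hN1, hN2⟩ : ∃ N : ℕ, (N + 1 : ℝ) * h ≤ 1 ∧ 1 < (N + 2 : ℝ) * h := by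
    have h1 : 1 ≤ ⌊1 / h⌋₊ := by
      rw [Nat.one_le_floor_iff, le_div_iff₀ hpos]
      linarith
    refine ⟨⌊1 / h⌋₊ - 1, ?_, ?_⟩
    · rw [Nat.cast_sub h1, ← le_div_iff₀ hpos]
      have := Nat.floor_le (a := 1 / h) (by positivity)
      push_cast; linarith
    · rw [Nat.cast_sub h1, ← div_lt_iff₀ hpos]
      have := Nat.lt_floor_add_one (1 / h)
      push_cast; linarith
  set I : ℕ → ℝ := fun j => ∫ x in (j * h)..((j + 1 : ℕ) * h), f x with hI
  -- Comparing the two halves of the interval starting at `j * h` gives a lower bound that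
  -- telescopes over all `j`. Intervals whose indices have the same parity are disjoint.
  set c : ℕ → ℝ := fun j => ε⁻¹ * (I (j + 1) - I j) with hc
  have hfam : ∀ P : ℕ → Prop, ∀ [DecidablePred P], (∀ i j, P i → P j → i < j → i + 2 ≤ j) →
      ENNReal.ofReal (∑ i ∈ (Finset.range N).filter P, c i) ≤ K ε f (Ioo 0 1) := by
    intro P _ hP
    refine le_K hε _ (fun j => j * h) c ?_ ?_ ?_
    · intro i hi
      have hi : i + 1 ≤ N := (Finset.mem_range.1 (Finset.mem_filter.1 hi).1)
      have hi' : (i + 1 : ℝ) ≤ N := by exact_mod_cast hi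
      refine Ioo_subset_Ioo (by positivity) ?_
      nlinarith
    · intro i hi j hj hij
      have := hP i j (Finset.mem_filter.1 hi).2 (Finset.mem_filter.1 hj).2 hij
      have h' : (i + 2 : ℝ) ≤ j := by exact_mod_cast this
      nlinarith
    · intro i _
      have := le_osc hf (a := i * h) (b := i * h + ε) (h := h) (by linarith) hpos.le (by linarith)
      refine le_trans (le_of_eq ?_) this
      have e1 : (i * h + ε - h : ℝ) = (i + 1 : ℕ) * h := by push_cast; rw [hh]; ring
      have e2 : (i * h + ε : ℝ) = (i + 1 + 1 : ℕ) * h := by push_cast; rw [hh]; ring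
      have e3 : (i * h + h : ℝ) = (i + 1 : ℕ) * h := by push_cast; ring
      have e4 : (i * h + ε - i * h : ℝ) = ε := by ring
      rw [e4, e1, e2, e3]
  have heven := hfam Even fun i j hi hj hij => by
    obtain ⟨x, rfl⟩ := hi
    obtain ⟨y, rfl⟩ := hj
    omega
  have hodd := hfam (fun i => ¬ Even i) fun i j hi hj hij => by
    obtain ⟨x, rfl⟩ := Nat.not_even_iff_odd.1 hi
    obtain ⟨y, rfl⟩ := Nat.not_even_iff_odd.1 hj
    omega
  have hsum := Finset.sum_filter_add_sum_filter_not (Finset.range N) (Even (α := ℕ)) c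
  have htel : ∑ i ∈ Finset.range N, c i = ε⁻¹ * (I N - I 0) := by
    rw [← Finset.mul_sum, Finset.sum_range_sub]
  have hi : ∀ a b, IntervalIntegrable f volume a b := fun _ _ => hf.intervalIntegrable
  have hIN : h * f (1 - ε) ≤ I N := by
    have : ∫ x in (N * h)..((N + 1 : ℕ) * h), f (1 - ε) ≤ I N :=
      intervalIntegral.integral_mono_on (by push_cast; nlinarith) (by simp) (hi _ _)
        fun x hx => hf (by nlinarith [hx.1])
    rw [intervalIntegral.integral_const, smul_eq_mul] at this
    push_cast at this
    linarith
  have hI0 : I 0 ≤ h * f ε := by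
    have : I 0 ≤ ∫ x in ((0 : ℕ) * h)..((0 + 1 : ℕ) * h), f ε :=
      intervalIntegral.integral_mono_on (by push_cast; nlinarith) (hi _ _) (by simp)
        fun x hx => hf (by have := hx.2; push_cast at this; linarith)
    rw [intervalIntegral.integral_const, smul_eq_mul] at this
    push_cast at this
    linarith
  have htot : (f (1 - ε) - f ε) / 2 ≤ ∑ i ∈ Finset.range N, c i := by
    rw [htel, le_inv_mul_iff₀ hε]
    rw [hh] at hIN hI0
    linarith
  rcases le_total (∑ i ∈ (Finset.range N).filter Even, c i)
    (∑ i ∈ (Finset.range N).filter (fun i => ¬ Even i), c i) with h' | h'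
  · exact (ENNReal.ofReal_le_ofReal (by linarith)).trans hodd
  · exact (ENNReal.ofReal_le_ofReal (by linarith)).trans heven

/-! ### Staircases -/

/-- A monotone `Λ`-Lipschitz function from `0` to `1` such that, for every `j < M`, the values
between `j / M` and `(j + 1) / M` are taken along an affine piece of slope `Λ`
with left endpoint `a j`. -/
structure IsStaircase (F : ℝ → ℝ) (Λ : ℝ) (M : ℕ) (a : ℕ → ℝ) : Prop where
  mono : Monotone F
  zero : ∀ x ≤ 0, F x = 0
  one : ∀ x, 1 ≤ x → F x = 1
  lip : ∀ x y, x ≤ y → F y - F x ≤ Λ * (y - x)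
  cell : ∀ j < M, ∀ s, 0 ≤ s → s ≤ 1 / (M * Λ) → F (a j + s) = j / M + Λ * s

/-- The union of the closed intervals along which a staircase increases. -/
def riseSet (Λ : ℝ) (M : ℕ) (a : ℕ → ℝ) : Set ℝ :=
  ⋃ j ∈ Finset.range M, Icc (a j) (a j + 1 / (M * Λ))

namespace IsStaircase

variable {F : ℝ → ℝ} {Λ : ℝ} {M : ℕ} {a : ℕ → ℝ}

lemma mem_Icc (h : IsStaircase F Λ M a) (x : ℝ) : F x ∈ Icc (0 : ℝ) 1 := by
  constructor
  · rw [← h.zero (min x 0) (min_le_right _ _)]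
    exact h.mono (min_le_left _ _)
  · rw [← h.one (max x 1) (le_max_right _ _)]
    exact h.mono (le_max_left _ _)

lemma one_le_slope (h : IsStaircase F Λ M a) : 1 ≤ Λ := by
  have h1 := h.lip 0 1 zero_le_one
  rw [h.zero 0 le_rfl, h.one 1 le_rfl] at h1
  linarith

lemma continuous (h : IsStaircase F Λ M a) : Continuous F := by
  have : LipschitzWith (Real.toNNReal Λ) F := by
    refine LipschitzWith.of_dist_le_mul fun x y => ?_
    rw [Real.coe_toNNReal _ (zero_le_one.trans h.one_le_slope), Real.dist_eq, Real.dist_eq]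
    rcases le_total x y with hxy | hxy
    · rw [abs_of_nonpos (by linarith [h.mono hxy]), abs_of_nonpos (by linarith)]
      linarith [h.lip x y hxy]
    · rw [abs_of_nonneg (by linarith [h.mono hxy]), abs_of_nonneg (by linarith)]
      linarith [h.lip y x hxy]
  exact this.continuous

/-- A staircase is constant between two points unless it has a rise interval there. -/
lemma exists_mem_riseSet (h : IsStaircase F Λ M a) (hM : 0 < M) {x y : ℝ} (hxy : F x < F y) :
    ∃ z ∈ riseSet Λ M a, z ∈ Ioo x y := by
  have hM' : (0 : ℝ) < M := by exact_mod_cast hM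
  have hΛ : 0 < Λ := zero_lt_one.trans_le h.one_le_slope
  have hx0 := (h.mem_Icc x).1
  have hx1 : F x < 1 := hxy.trans_le (h.mem_Icc y).2
  set j := ⌊F x * M⌋₊ with hj
  have hj1 : (j : ℝ) ≤ F x * M := Nat.floor_le (by positivity)
  have hj2 : F x * M < j + 1 := Nat.lt_floor_add_one _
  have hjM : j < M := by
    have : (j : ℝ) < M := by nlinarith
    exact_mod_cast this
  -- A value strictly between `F x` and `F y` in the `j`-th level is attained on the `j`-th rise,
  -- and monotonicity puts that point between `x` and `y`.
  obtain ⟨t, ht1, ht2⟩ : ∃ t, F x < t ∧ t < min (F y) ((j + 1) / M) :=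
    exists_between (lt_min hxy (by rwa [lt_div_iff₀ hM']))
  have ht3 := ht2.trans_le (min_le_right _ _)
  rw [lt_div_iff₀ hM'] at ht3
  have hs0 : 0 ≤ (t - j / M) / Λ := by
    refine div_nonneg ?_ hΛ.le
    rw [sub_nonneg, div_le_iff₀ hM']
    nlinarith
  have hs1 : (t - j / M) / Λ ≤ 1 / (M * Λ) := by
    rw [div_le_div_iff₀ hΛ (by positivity)]
    have : (t - j / M) * M ≤ 1 := by rw [sub_mul, div_mul_cancel₀ _ hM'.ne']; linarith
    nlinarith
  have hz : F (a j + (t - j / M) / Λ) = t := by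
    rw [h.cell j hjM _ hs0 hs1]
    field_simp
    ring
  refine ⟨a j + (t - j / M) / Λ, ?_, ?_, ?_⟩
  · simp only [riseSet, mem_iUnion]
    exact ⟨j, Finset.mem_range.2 hjM, by linarith, by linarith⟩
  · by_contra hle
    have := h.mono (not_lt.1 hle)
    linarith
  · by_contra hle
    have := h.mono (not_lt.1 hle)
    linarith [ht2.trans_le (min_le_left _ _)]

lemma volume_riseSet_le (h : IsStaircase F Λ M a) (hM : 0 < M) :
    volume (riseSet Λ M a) ≤ ENNReal.ofReal (1 / Λ) := by
  have hM' : (0 : ℝ) < M := by exact_mod_cast hM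
  have hΛ : 0 < Λ := zero_lt_one.trans_le h.one_le_slope
  calc volume (riseSet Λ M a)
      ≤ ∑ j ∈ Finset.range M, volume (Icc (a j) (a j + 1 / (M * Λ))) :=
        measure_biUnion_finset_le _ _
    _ = ∑ j ∈ Finset.range M, ENNReal.ofReal (1 / (M * Λ)) := by
        simp only [Real.volume_Icc, add_sub_cancel_left]
    _ = ENNReal.ofReal (1 / Λ) := by
        rw [Finset.sum_const, Finset.card_range, nsmul_eq_mul, ← ENNReal.ofReal_natCast,
          ← ENNReal.ofReal_mul hM'.le]
        congr 1
        field_simp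

/-- Intervals meeting a rise lie in the `ε`-neighbourhood of the rises, of measure at most `1 / Λ +
2 * M * ε`, and there the affine bound applies up to `2 * δ`. On the others `f` is exactly constant
by `hconst`; closeness to `F` alone would cost `2 * δ` on each of them, which is too much at the
scale used. -/
lemma K_le (h : IsStaircase F Λ M a) (hM : 0 < M) {f : ℝ → ℝ} (hf : Monotone f) {δ ε : ℝ}
    (hε : 0 < ε) (hδ : 0 ≤ δ) (hd : ∀ x, |f x - F x| ≤ δ)
    (hconst : ∀ x y, F x = F y → f x = f y) (Ω : Set ℝ) :
    K ε f Ω ≤ ENNReal.ofReal ((Λ / 4 + 2 * δ / ε) * (1 / Λ + 2 * M * ε)) := by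
  have hM' : (0 : ℝ) < M := by exact_mod_cast hM
  have hΛ : 0 < Λ := zero_lt_one.trans_le h.one_le_slope
  have hC : 0 ≤ Λ / 4 + 2 * δ / ε := by positivity
  set R := ⋃ j ∈ Finset.range M, Ioo (a j - ε) (a j + 1 / (M * Λ) + ε) with hR
  have hRm : MeasurableSet R :=
    Finset.measurableSet_biUnion _ fun _ _ => measurableSet_Ioo
  refine (K_le_measure (ENNReal.ofReal (Λ / 4 + 2 * δ / ε) • volume.restrict R)
    fun b _ => ?_).trans ?_
  · have hb : b < b + ε := by linarith
    by_cases hint : (Ioo b (b + ε) ∩ riseSet Λ M a).Nonempty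
    · obtain ⟨z, hz, hzR⟩ := hint
      simp only [riseSet, mem_iUnion] at hzR
      obtain ⟨j, hj, hzj⟩ := hzR
      have hsub : Ioo b (b + ε) ⊆ R := fun x hx => by
        simp only [hR, mem_iUnion]
        exact ⟨j, hj, by linarith [hx.1, hx.2, hz.1, hz.2, hzj.1, hzj.2],
          by linarith [hx.1, hx.2, hz.1, hz.2, hzj.1, hzj.2]⟩
      rw [Measure.smul_apply, Measure.restrict_apply measurableSet_Ioo,
        inter_eq_self_of_subset_left hsub, Real.volume_Ioo, add_sub_cancel_left, smul_eq_mul,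
        ← ENNReal.ofReal_mul hC]
      apply ENNReal.ofReal_le_ofReal
      have h1 := osc_le_osc_add hf h.mono hd hb
      have h2 := osc_le_of_lipschitz h.mono h.continuous h.lip hb
      have : (Λ / 4 + 2 * δ / ε) * ε = Λ * (b + ε - b) / 4 + 2 * δ := by field_simp; ring
      linarith
    · have hFc : F b = F (b + ε) := by
        by_contra hne
        obtain ⟨z, hzR, hz⟩ := h.exists_mem_riseSet hM ((h.mono hb.le).lt_of_ne hne)
        exact hint ⟨z, hz, hzR⟩
      have h1 := osc_le_half hf hb
      rw [hconst _ _ hFc, sub_self, zero_div] at h1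
      rw [ENNReal.ofReal_of_nonpos h1]
      exact zero_le
  · rw [Measure.smul_apply, smul_eq_mul, ENNReal.ofReal_mul hC]
    gcongr
    calc volume.restrict R Ω ≤ volume R :=
          (measure_mono (subset_univ _)).trans_eq (Measure.restrict_apply_univ _)
      _ ≤ ∑ j ∈ Finset.range M, volume (Ioo (a j - ε) (a j + 1 / (M * Λ) + ε)) :=
          measure_biUnion_finset_le _ _
      _ = ∑ j ∈ Finset.range M, ENNReal.ofReal (1 / (M * Λ) + 2 * ε) := by
          refine Finset.sum_congr rfl fun j _ => ?_
          rw [Real.volume_Ioo]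
          congr 1
          ring
      _ = ENNReal.ofReal (1 / Λ + 2 * M * ε) := by
          rw [Finset.sum_const, Finset.card_range, nsmul_eq_mul, ← ENNReal.ofReal_natCast,
            ← ENNReal.ofReal_mul hM'.le]
          congr 1
          field_simp

/-- Subdividing every affine piece into `m` pieces. -/
lemma refine (h : IsStaircase F Λ M a) (hM : 0 < M) {m : ℕ} (hm : 0 < m) :
    IsStaircase F Λ (M * m) (fun j => a (j / m) + (j % m : ℕ) / (M * m * Λ)) where
  mono := h.mono
  zero := h.zero
  one := h.one
  lip := h.lip
  cell j hj s h0 h1 := by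
    have hM' : (0 : ℝ) < M := by exact_mod_cast hM
    have hm' : (0 : ℝ) < m := by exact_mod_cast hm
    have hΛ : 0 < Λ := zero_lt_one.trans_le h.one_le_slope
    have hlt : j / m < M := Nat.div_lt_of_lt_mul (by rwa [mul_comm])
    have hmod : ((j % m : ℕ) : ℝ) + 1 ≤ m := by exact_mod_cast Nat.mod_lt j hm
    have hj' : (j : ℝ) = m * (j / m : ℕ) + (j % m : ℕ) := by exact_mod_cast (Nat.div_add_mod j m).symm
    push_cast at h1
    rw [add_assoc, h.cell _ hlt _ (by positivity)]
    · rw [hj']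
      push_cast
      field_simp
      ring
    · calc ((j % m : ℕ) : ℝ) / (M * m * Λ) + s ≤ (j % m : ℕ) / (M * m * Λ) + 1 / (M * m * Λ) := by
            gcongr
        _ = ((j % m : ℕ) + 1) / (M * m * Λ) := by ring
        _ ≤ m / (M * m * Λ) := by gcongr
        _ = 1 / (M * Λ) := by field_simp

end IsStaircase

/-! ### Concentrating the increase on central parts of cells -/

/-- The ramp of slope `1 / ρ` from `0` to `1` centred at `1 / 2`. -/
noncomputable def ramp (ρ t : ℝ) : ℝ := max 0 (min 1 ((t - (1 - ρ) / 2) / ρ))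

/-- The identity made to increase only on the central parts, of proportion `ρ`, of the
intervals `[j / M, (j + 1) / M]`. -/
noncomputable def concentrate (ρ : ℝ) (M : ℕ) (y : ℝ) : ℝ :=
  (⌊M * y⌋ + ramp ρ (Int.fract (M * y))) / M

lemma ramp_nonneg (ρ t : ℝ) : 0 ≤ ramp ρ t := le_max_left _ _

lemma ramp_le_one (ρ t : ℝ) : ramp ρ t ≤ 1 := max_le zero_le_one (min_le_left _ _)

lemma ramp_mono {ρ : ℝ} (h0 : 0 < ρ) : Monotone (ramp ρ) := fun s t hst => by
  unfold ramp
  gcongr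

lemma ramp_sub_le {ρ : ℝ} (h0 : 0 < ρ) {s t : ℝ} (hst : s ≤ t) : ramp ρ t - ramp ρ s ≤ (t - s) / ρ := by
  have key : (t - (1 - ρ) / 2) / ρ = (s - (1 - ρ) / 2) / ρ + (t - s) / ρ := by ring
  have : 0 ≤ (t - s) / ρ := div_nonneg (by linarith) h0.le
  unfold ramp
  rw [key]
  set u := (s - (1 - ρ) / 2) / ρ
  set v := (t - s) / ρ
  rcases max_cases 0 (min 1 (u + v)) with h | h <;> rcases max_cases 0 (min 1 u) with h' | h' <;>
    rcases min_cases 1 (u + v) with h2 | h2 <;> rcases min_cases 1 u with h3 | h3 <;> linarith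

lemma ramp_zero {ρ : ℝ} (h0 : 0 < ρ) (h1 : ρ < 1) : ramp ρ 0 = 0 := by
  refine max_eq_left ((min_le_right _ _).trans ?_)
  exact div_nonpos_of_nonpos_of_nonneg (by linarith) h0.le

lemma ramp_one {ρ : ℝ} (h0 : 0 < ρ) (h1 : ρ < 1) : ramp ρ 1 = 1 := by
  have : 1 ≤ (1 - (1 - ρ) / 2) / ρ := by rw [le_div_iff₀ h0]; linarith
  rw [ramp, min_eq_left this]
  simp

lemma concentrate_mono {ρ : ℝ} (h0 : 0 < ρ) (M : ℕ) : Monotone (concentrate ρ M) := fun x y hxy => by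
  unfold concentrate
  gcongr ?_ / _
  have hxy' : (M : ℝ) * x ≤ M * y := by gcongr
  rcases (Int.floor_mono hxy').eq_or_lt with h | h
  · rw [h]
    have : Int.fract ((M : ℝ) * x) ≤ Int.fract ((M : ℝ) * y) := by
      rw [Int.fract, Int.fract, h]; linarith
    linarith [ramp_mono h0 this]
  · have : (⌊(M : ℝ) * x⌋ : ℝ) + 1 ≤ ⌊(M : ℝ) * y⌋ := by exact_mod_cast h
    linarith [ramp_nonneg ρ (Int.fract ((M : ℝ) * y)), ramp_le_one ρ (Int.fract ((M : ℝ) * x))]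

lemma concentrate_sub_le {ρ : ℝ} (h0 : 0 < ρ) (h1 : ρ < 1) {M : ℕ} (hM : 0 < M) {x y : ℝ} (hxy : x ≤ y) :
    concentrate ρ M y - concentrate ρ M x ≤ (y - x) / ρ := by
  have hM' : (0 : ℝ) < M := by exact_mod_cast hM
  unfold concentrate
  rw [← sub_div, div_le_iff₀ hM']
  have hxy' : (M : ℝ) * x ≤ M * y := by gcongr
  have e : (y - x) / ρ * M = (M * y - M * x) / ρ := by ring
  rw [e]
  set p := (M : ℝ) * x
  set q := (M : ℝ) * y
  have hp := Int.floor_add_fract p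
  have hq := Int.floor_add_fract q
  rcases (Int.floor_mono hxy').eq_or_lt with h | h
  · have hle : Int.fract p ≤ Int.fract q := by
      rw [Int.fract, Int.fract, h]; linarith
    have h2 := ramp_sub_le h0 hle
    have : q - p = Int.fract q - Int.fract p := by rw [Int.fract, Int.fract, h]; ring
    rw [this, h]
    linarith
  · have hfl : (⌊p⌋ : ℝ) + 1 ≤ ⌊q⌋ := by exact_mod_cast h
    have a1 := ramp_sub_le h0 (Int.fract_nonneg q)
    have a2 := ramp_sub_le h0 (Int.fract_lt_one p).le
    rw [ramp_zero h0 h1] at a1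
    rw [ramp_one h0 h1] at a2
    have a3 : (⌊q⌋ - ⌊p⌋ - 1 : ℝ) ≤ (⌊q⌋ - ⌊p⌋ - 1) / ρ := by
      rw [le_div_iff₀ h0]; nlinarith
    -- Between different cells: the rest of the first cell, the whole cells in between, the start of
    -- the last one.
    have : (q - p) / ρ = (⌊q⌋ - ⌊p⌋ - 1) / ρ + (Int.fract q - 0) / ρ + (1 - Int.fract p) / ρ := by
      rw [← add_div, ← add_div]
      congr 1
      linarith
    rw [this]
    linarith

lemma abs_concentrate_sub_le (ρ : ℝ) {M : ℕ} (hM : 0 < M) (y : ℝ) : |concentrate ρ M y - y| ≤ 1 / M := by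
  have hM' : (0 : ℝ) < M := by exact_mod_cast hM
  have e : concentrate ρ M y - y = (ramp ρ (Int.fract (M * y)) - Int.fract (M * y)) / M := by
    have := Int.floor_add_fract ((M : ℝ) * y)
    rw [concentrate, eq_div_iff hM'.ne', sub_mul, div_mul_cancel₀ _ hM'.ne']
    linarith
  rw [e, abs_div, abs_of_pos hM']
  gcongr
  rw [abs_le]
  constructor <;> linarith [ramp_nonneg ρ (Int.fract ((M : ℝ) * y)),
    ramp_le_one ρ (Int.fract ((M : ℝ) * y)), Int.fract_nonneg ((M : ℝ) * y),
    Int.fract_lt_one ((M : ℝ) * y)]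

lemma concentrate_apply (ρ : ℝ) {M : ℕ} (hM : 0 < M) (j : ℕ) {t : ℝ} (ht : 0 ≤ t) (ht1 : t < 1) :
    concentrate ρ M ((j + t) / M) = (j + ramp ρ t) / M := by
  have hM' : (0 : ℝ) < M := by exact_mod_cast hM
  have e : (M : ℝ) * ((j + t) / M) = t + (j : ℤ) := by push_cast; field_simp; ring
  have hfr : Int.fract t = t := Int.fract_eq_self.2 ⟨ht, ht1⟩
  have hfl : ⌊t⌋ = 0 := Int.floor_eq_zero_iff.2 ⟨ht, ht1⟩
  rw [concentrate, e, Int.fract_add_intCast, Int.floor_add_intCast, hfr, hfl]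
  simp

lemma concentrate_natCast_div {ρ : ℝ} (h0 : 0 < ρ) (h1 : ρ < 1) {M : ℕ} (hM : 0 < M) (j : ℕ) : concentrate ρ M (j / M) = j / M := by
  have := concentrate_apply ρ hM j le_rfl zero_lt_one
  rwa [add_zero, ramp_zero h0 h1, add_zero] at this

lemma IsStaircase.comp_concentrate {F : ℝ → ℝ} {Λ ρ : ℝ} {M : ℕ} {a : ℕ → ℝ}
    (h0 : 0 < ρ) (h1 : ρ < 1) (hM : 0 < M) (h : IsStaircase F Λ M a) :
    IsStaircase (fun x => concentrate ρ M (F x)) (Λ / ρ) M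
      (fun j => a j + (1 - ρ) / 2 / (M * Λ)) := by
  have hM' : (0 : ℝ) < M := by exact_mod_cast hM
  have hΛ : 0 < Λ := zero_lt_one.trans_le h.one_le_slope
  refine ⟨(concentrate_mono h0 M).comp h.mono, fun x hx => ?_, fun x hx => ?_,
    fun x y hxy => ?_, fun j hj s hs0 hs1 => ?_⟩
  · have := concentrate_natCast_div h0 h1 hM 0
    rw [Nat.cast_zero, zero_div] at this
    change concentrate ρ M (F x) = 0
    rw [h.zero x hx, this]
  · have := concentrate_natCast_div h0 h1 hM M
    rw [div_self hM'.ne'] at this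
    change concentrate ρ M (F x) = 1
    rw [h.one x hx, this]
  · refine (concentrate_sub_le h0 h1 hM (h.mono hxy)).trans ?_
    rw [div_mul_eq_mul_div]
    gcongr
    exact h.lip x y hxy
  · have hs1' : s * (M * Λ) ≤ ρ := by
      have : s ≤ ρ / (M * Λ) := hs1.trans (le_of_eq (by field_simp))
      rwa [le_div_iff₀ (by positivity)] at this
    -- In units of the old rise length `1 / (M * Λ)` the new rise runs from `(1 - ρ) / 2` to `(1 +
    -- ρ) / 2`, the sloped part of the ramp.
    have hs0' : 0 ≤ s * (M * Λ) := by positivity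
    rw [add_assoc, h.cell j hj]
    · have e : (j / M + Λ * ((1 - ρ) / 2 / (M * Λ) + s) : ℝ) =
          (j + ((1 - ρ) / 2 + s * (M * Λ))) / M := by field_simp
      rw [e, concentrate_apply ρ hM j (by linarith) (by linarith), ramp, add_sub_cancel_left,
        min_eq_right ((div_le_one h0).2 hs1'), max_eq_right (by positivity)]
      field_simp
    · have : 0 ≤ (1 - ρ) / 2 / (M * Λ) := div_nonneg (by linarith) (by positivity)
      linarith
    · rw [le_div_iff₀ (by positivity), add_mul, div_mul_cancel₀ _ (by positivity)]
      linarith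

/-- A monotone function close to a concentrated staircase has almost half of its variation
as oscillation on the affine pieces of the original staircase. -/
lemma IsStaircase.le_K {F f : ℝ → ℝ} {Λ : ℝ} {M : ℕ} {a : ℕ → ℝ} (h : IsStaircase F Λ M a)
    (hM : 0 < M) {ρ δ : ℝ} (h0 : 0 < ρ) (h1 : ρ < 1) (hf : Monotone f)
    (hd : ∀ x, |f x - concentrate ρ M (F x)| ≤ δ) :
    ENNReal.ofReal ((1 - ρ) / 2 * (1 - 2 * (M * δ))) ≤ K (1 / (M * Λ)) f (Ioo 0 1) := by
  have hM' : (0 : ℝ) < M := by exact_mod_cast hM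
  have hΛ : 0 < Λ := zero_lt_one.trans_le h.one_le_slope
  set ε := 1 / (M * Λ) with hε
  have hε0 : 0 < ε := by positivity
  have hεM : Λ * ε = 1 / M := by rw [hε]; field_simp
  have hcell := h.cell
  have key := OneDimBV.le_K (f := f) (Ω := Ioo 0 1) hε0 (Finset.range M) a
    (fun _ => (1 - ρ) / 2 * (1 / M - 2 * δ)) ?_ ?_ ?_
  · refine le_trans (le_of_eq ?_) key
    rw [Finset.sum_const, Finset.card_range, nsmul_eq_mul]
    congr 1
    field_simp
  · intro j hj x hx
    have hj := Finset.mem_range.1 hj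
    have hjM : (j + 1 : ℝ) ≤ M := by exact_mod_cast hj
    have e := hcell j hj (x - a j) (by linarith [hx.1]) (by linarith [hx.2])
    rw [add_sub_cancel] at e
    have p1 : 0 < Λ * (x - a j) := mul_pos hΛ (by linarith [hx.1])
    have p2 : Λ * (x - a j) < 1 / M := by
      rw [← hεM]
      exact mul_lt_mul_of_pos_left (by linarith [hx.2]) hΛ
    constructor
    · by_contra hle
      rw [h.zero x (not_lt.1 hle)] at e
      have : (0 : ℝ) ≤ j / M := by positivity
      linarith
    · by_contra hle
      rw [h.one x (not_lt.1 hle)] at e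
      have : (j / M + 1 / M : ℝ) ≤ 1 := by rw [← add_div, div_le_one hM']; exact hjM
      linarith
  · intro i hi j hj hij
    have hi := Finset.mem_range.1 hi
    have hj := Finset.mem_range.1 hj
    by_contra hlt
    push Not at hlt
    have e1 := hcell i hi ε hε0.le le_rfl
    have hx : a j < min (a i) (a j) + ε := by
      rcases min_cases (a i) (a j) with h | h <;> rw [h.1] <;> linarith
    -- If the pieces overlapped, a point just inside piece `j` would have value above `j / M`, yet
    -- at most `(i + 1) / M`, the value at the end of piece `i`.
    obtain ⟨s, hs0, hs1, hs2⟩ : ∃ s, 0 < s ∧ s ≤ ε ∧ a j + s ≤ a i + ε :=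
      ⟨min ε (a i + ε - a j), lt_min hε0 (by linarith), min_le_left _ _, by
        linarith [min_le_right ε (a i + ε - a j)]⟩
    have e2 := hcell j hj s hs0.le hs1
    have e3 := h.mono hs2
    rw [e1, e2, hεM, ← add_div] at e3
    have : ((i + 1 : ℝ)) / M ≤ j / M := by
      gcongr
      exact_mod_cast hij
    have := mul_pos hΛ hs0
    linarith
  · intro j hj
    have hj := Finset.mem_range.1 hj
    have hk0 : 0 ≤ (1 - ρ) / 2 * ε := mul_nonneg (by linarith) hε0.le
    -- The end parts of length `(1 - ρ) / 2 * ε` are the flat parts on either side of the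
    -- concentrated rise, so the whole increment `1 / M` lies between them, up to `2 * δ`.
    have := le_osc_of_ends hf (a := a j) (b := a j + ε) (h := (1 - ρ) / 2 * ε) (by linarith) hk0
      (by nlinarith)
    refine le_trans ?_ this
    rw [add_sub_cancel_left, mul_assoc, mul_left_comm ε⁻¹, inv_mul_cancel_left₀ hε0.ne']
    gcongr ?_ * ?_
    have e1 : concentrate ρ M (F (a j + (1 - ρ) / 2 * ε)) = j / M := by
      rw [hcell j hj _ hk0 (by nlinarith)]
      have : (j / M + Λ * ((1 - ρ) / 2 * ε) : ℝ) = (j + (1 - ρ) / 2) / M := by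
        rw [mul_left_comm, hεM]; ring
      rw [this, concentrate_apply ρ hM j (by linarith) (by linarith), ramp, sub_self, zero_div,
        min_eq_right zero_le_one, max_self, add_zero]
    have e2 : concentrate ρ M (F (a j + ε - (1 - ρ) / 2 * ε)) = (j + 1) / M := by
      rw [add_sub_assoc, hcell j hj _ (by nlinarith) (by linarith)]
      have : (j / M + Λ * (ε - (1 - ρ) / 2 * ε) : ℝ) = (j + (1 + ρ) / 2) / M := by
        rw [show ε - (1 - ρ) / 2 * ε = (1 + ρ) / 2 * ε by ring, mul_left_comm, hεM]; ring
      rw [this, concentrate_apply ρ hM j (by linarith) (by linarith), ramp,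
        show ((1 + ρ) / 2 - (1 - ρ) / 2) / ρ = 1 by field_simp; ring, min_self,
        max_eq_right zero_le_one]
    have d1 := abs_le.1 (hd (a j + (1 - ρ) / 2 * ε))
    have d2 := abs_le.1 (hd (a j + ε - (1 - ρ) / 2 * ε))
    rw [e1] at d1
    rw [e2, add_div] at d2
    linarith [d1.2, d2.1]

/-! ### The approximating staircases and their limit -/

/-- The slope of the `n`-th approximation. -/
noncomputable def slope (n : ℕ) : ℝ := (n + 1).factorial

/-- The number of rise intervals of the `n`-th approximation. -/
def pieces (n : ℕ) : ℕ := (n + 1).factorial ^ 2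

/-- The approximating staircases. -/
noncomputable def approx : ℕ → ℝ → ℝ
  | 0 => fun x => max 0 (min 1 x)
  | n + 1 => fun x => concentrate (1 / (n + 2)) (pieces (n + 1)) (approx n x)

lemma slope_pos (n : ℕ) : 0 < slope n := by
  unfold slope; positivity

lemma slope_succ (n : ℕ) : slope (n + 1) = slope n * (n + 2) := by
  unfold slope
  rw [Nat.factorial_succ (n + 1)]
  push_cast
  ring

lemma natCast_add_one_le_slope (n : ℕ) : (n : ℝ) + 1 ≤ slope n := by
  unfold slope
  exact_mod_cast Nat.self_le_factorial (n + 1)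

lemma pieces_pos (n : ℕ) : 0 < pieces n := by
  unfold pieces; positivity

lemma natCast_pieces (n : ℕ) : (pieces n : ℝ) = slope n ^ 2 := by
  unfold slope pieces; push_cast; rfl

lemma pieces_succ (n : ℕ) : pieces (n + 1) = pieces n * (n + 2) ^ 2 := by
  unfold pieces
  rw [Nat.factorial_succ (n + 1)]
  ring

lemma isStaircase_approx_zero :
    IsStaircase (approx 0) (slope 0) (pieces 0) (fun _ => 0) := by
  have e1 : slope 0 = 1 := by simp [slope]
  have e2 : pieces 0 = 1 := by simp [pieces]
  rw [e1, e2]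
  refine ⟨fun x y hxy => ?_, fun x hx => ?_, fun x hx => ?_, fun x y hxy => ?_,
    fun j hj s h0 h1 => ?_⟩
  · simp only [approx]
    gcongr
  · simp only [approx]
    rw [min_eq_right (by linarith), max_eq_left hx]
  · simp only [approx]
    rw [min_eq_left hx, max_eq_right zero_le_one]
  · simp only [approx]
    rcases max_cases 0 (min 1 x) with h | h <;> rcases max_cases 0 (min 1 y) with h' | h' <;>
      rcases min_cases 1 x with h2 | h2 <;> rcases min_cases 1 y with h3 | h3 <;> linarith
  · obtain rfl : j = 0 := by omega
    simp only [approx]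
    rw [zero_add, min_eq_right (by simpa using h1), max_eq_right h0]
    simp

lemma one_div_natCast_add_two_pos (n : ℕ) : (0 : ℝ) < 1 / (n + 2) := by positivity

lemma one_div_natCast_add_two_lt_one (n : ℕ) : (1 : ℝ) / (n + 2) < 1 := by
  rw [div_lt_one (by positivity)]
  have : (0 : ℝ) ≤ n := n.cast_nonneg
  linarith

lemma exists_isStaircase_approx (n : ℕ) :
    ∃ a, IsStaircase (approx n) (slope n) (pieces n) a := by
  induction n with
  | zero => exact ⟨_, isStaircase_approx_zero⟩
  | succ n ih =>
    obtain ⟨a, ha⟩ := ih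
    have h := ha.refine (pieces_pos n) (m := (n + 2) ^ 2) (by positivity)
    rw [← pieces_succ] at h
    have h' := h.comp_concentrate (one_div_natCast_add_two_pos n)
      (one_div_natCast_add_two_lt_one n) (pieces_pos _)
    have e : slope n / (1 / (n + 2)) = slope (n + 1) := by
      rw [slope_succ]; field_simp
    rw [e] at h'
    exact ⟨_, h'⟩

lemma approx_mono (n : ℕ) : Monotone (approx n) :=
  (exists_isStaircase_approx n).choose_spec.mono

lemma abs_approx_succ_sub_le (n : ℕ) (x : ℝ) :
    |approx (n + 1) x - approx n x| ≤ 1 / pieces (n + 1) :=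
  abs_concentrate_sub_le _ (pieces_pos _) _

/-- The corrections `1 / pieces (n + 1)` decay faster than geometrically with ratio 1/2, so twice
the first one bounds the tail. Hence `approx n x ∓ 2 / pieces (n + 1)` are monotone brackets of the
limit. -/
lemma two_div_pieces_gap (n : ℕ) :
    (1 : ℝ) / pieces (n + 1) ≤ 2 / pieces (n + 1) - 2 / pieces (n + 2) := by
  have h : (0 : ℝ) < pieces (n + 1) := by exact_mod_cast pieces_pos _
  have : (2 : ℝ) / pieces (n + 2) ≤ 1 / pieces (n + 1) := by
    rw [pieces_succ (n + 1)]
    push_cast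
    rw [div_le_div_iff₀ (by positivity) h]
    have h0 : (0 : ℝ) ≤ n := n.cast_nonneg
    nlinarith [mul_nonneg h.le h0, mul_nonneg h.le (mul_nonneg h0 h0)]
  have e : (2 : ℝ) / pieces (n + 1) = 1 / pieces (n + 1) + 1 / pieces (n + 1) := by ring
  linarith

lemma monotone_approx_sub (x : ℝ) : Monotone fun n => approx n x - 2 / pieces (n + 1) :=
  monotone_nat_of_le_succ fun n => by
    have h1 := (abs_le.1 (abs_approx_succ_sub_le n x)).1
    have h2 := two_div_pieces_gap n
    linarith

lemma antitone_approx_add (x : ℝ) : Antitone fun n => approx n x + 2 / pieces (n + 1) :=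
  antitone_nat_of_succ_le fun n => by
    have h1 := (abs_le.1 (abs_approx_succ_sub_le n x)).2
    have h2 := two_div_pieces_gap n
    linarith

lemma two_div_pieces_le (n : ℕ) : (2 : ℝ) / pieces (n + 1) ≤ 2 * (1 / (n + 1)) := by
  rw [natCast_pieces, mul_one_div]
  have h := natCast_add_one_le_slope (n + 1)
  have h0 : (0 : ℝ) ≤ n := n.cast_nonneg
  push_cast at h
  gcongr
  nlinarith

lemma tendsto_two_div_pieces : Tendsto (fun n : ℕ => (2 : ℝ) / pieces (n + 1)) atTop (𝓝 0) := by
  refine squeeze_zero (fun n => by positivity) two_div_pieces_le ?_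
  have := (tendsto_one_div_add_atTop_nhds_zero_nat (𝕜 := ℝ)).const_mul 2
  rwa [mul_zero] at this

/-- The limit of the staircases. -/
noncomputable def cantorLimit (x : ℝ) : ℝ := ⨆ n, (approx n x - 2 / pieces (n + 1))

lemma tendsto_approx (x : ℝ) : Tendsto (fun n => approx n x) atTop (𝓝 (cantorLimit x)) := by
  have hb : BddAbove (range fun n => approx n x - 2 / pieces (n + 1)) := by
    refine ⟨1, ?_⟩
    rintro _ ⟨n, rfl⟩
    obtain ⟨a, ha⟩ := exists_isStaircase_approx n
    have := (ha.mem_Icc x).2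
    have h2 : (0 : ℝ) ≤ 2 / pieces (n + 1) := by positivity
    change approx n x - 2 / pieces (n + 1) ≤ 1
    linarith
  have h := (tendsto_atTop_ciSup (monotone_approx_sub x) hb).add tendsto_two_div_pieces
  simpa [cantorLimit] using h

lemma abs_cantorLimit_sub_le (n : ℕ) (x : ℝ) :
    |cantorLimit x - approx n x| ≤ 2 / pieces (n + 1) := by
  have h1 : Tendsto (fun n => approx n x - 2 / pieces (n + 1)) atTop (𝓝 (cantorLimit x)) := by
    simpa using (tendsto_approx x).sub tendsto_two_div_pieces
  have h2 : Tendsto (fun n => approx n x + 2 / pieces (n + 1)) atTop (𝓝 (cantorLimit x)) := by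
    simpa using (tendsto_approx x).add tendsto_two_div_pieces
  have h1' := (monotone_approx_sub x).ge_of_tendsto h1 n
  have h2' := (antitone_approx_add x).le_of_tendsto h2 n
  rw [abs_le]
  constructor <;> linarith

lemma cantorLimit_mono : Monotone cantorLimit := fun x y hxy =>
  le_of_tendsto_of_tendsto' (tendsto_approx x) (tendsto_approx y) fun n => approx_mono n hxy

lemma cantorLimit_continuous : Continuous cantorLimit := by
  have : TendstoUniformly approx cantorLimit atTop := by
    rw [Metric.tendstoUniformly_iff]
    intro ε hε
    filter_upwards [tendsto_two_div_pieces.eventually_lt_const hε] with n hn x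
    exact (abs_cantorLimit_sub_le n x).trans_lt hn
  exact this.continuous (Frequently.of_forall fun n =>
    (exists_isStaircase_approx n).choose_spec.continuous)

lemma cantorLimit_of_nonpos {x : ℝ} (hx : x ≤ 0) : cantorLimit x = 0 :=
  tendsto_nhds_unique (tendsto_approx x)
    (tendsto_const_nhds.congr fun n => ((exists_isStaircase_approx n).choose_spec.zero x hx).symm)

lemma cantorLimit_of_one_le {x : ℝ} (hx : 1 ≤ x) : cantorLimit x = 1 :=
  tendsto_nhds_unique (tendsto_approx x)
    (tendsto_const_nhds.congr fun n => ((exists_isStaircase_approx n).choose_spec.one x hx).symm)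

/-- Later approximations are functions of earlier ones, so constancy is inherited, also by the
limit. -/
lemma approx_eq_of_le {n m : ℕ} (hnm : n ≤ m) {x y : ℝ} (h : approx n x = approx n y) :
    approx m x = approx m y := by
  induction m, hnm using Nat.le_induction with
  | base => exact h
  | succ m _ ih => simp only [approx, ih]

lemma cantorLimit_eq {n : ℕ} {x y : ℝ} (h : approx n x = approx n y) :
    cantorLimit x = cantorLimit y := by
  refine tendsto_nhds_unique (tendsto_approx x) ((tendsto_approx y).congr' ?_)
  filter_upwards [eventually_ge_atTop n] with m hm
  exact (approx_eq_of_le hm h).symm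

/-! ### The two sequences of scales -/

/-- With `s = slope n`, `δ = 2 / (s * (n + 2)) ^ 2` and this `ε`, the term `2 * δ / ε` is `4 * s /
(n + 2)`, small against the slope, and `2 * M * ε` is `2 / (s * (n + 2))`, small against `1 / s`. -/
lemma K_cantorLimit_le (n : ℕ) :
    K (1 / (slope n ^ 3 * (n + 2))) cantorLimit (Ioo 0 1) ≤
      ENNReal.ofReal ((1 / 4 + 4 * (1 / (n + 2))) * (1 + 2 * (1 / (n + 2)))) := by
  obtain ⟨a, ha⟩ := exists_isStaircase_approx n
  have hs := slope_pos n
  refine (ha.K_le (pieces_pos n) cantorLimit_mono (δ := 2 / pieces (n + 1))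
    (ε := 1 / (slope n ^ 3 * (n + 2))) (by positivity) (by positivity)
    (abs_cantorLimit_sub_le n) (fun x y h => cantorLimit_eq h) (Ioo 0 1)).trans (le_of_eq ?_)
  rw [natCast_pieces, natCast_pieces, slope_succ]
  congr 1
  field_simp
  norm_num

lemma le_K_cantorLimit (n : ℕ) :
    ENNReal.ofReal ((1 - 1 / (n + 2)) / 2 * (1 - 4 * (1 / (n + 3)) ^ 2)) ≤
      K (1 / (slope n ^ 3 * (n + 2) ^ 2)) cantorLimit (Ioo 0 1) := by
  obtain ⟨a, ha⟩ := exists_isStaircase_approx n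
  have hs := slope_pos n
  have h := ha.refine (pieces_pos n) (m := (n + 2) ^ 2) (by positivity)
  rw [← pieces_succ] at h
  -- The concentration of `approx n` is `approx (n + 1)` by definition, and the limit is within `2 /
  -- pieces (n + 2)` of it.
  have key := h.le_K (pieces_pos _) (one_div_natCast_add_two_pos n)
      (one_div_natCast_add_two_lt_one n) cantorLimit_mono (abs_cantorLimit_sub_le (n + 1))
  have e1 : (1 : ℝ) / (pieces (n + 1) * slope n) = 1 / (slope n ^ 3 * (n + 2) ^ 2) := by
    rw [natCast_pieces, slope_succ]
    ring
  rw [e1] at key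
  refine le_trans (le_of_eq ?_) key
  have hp : (0 : ℝ) < pieces (n + 1) := by exact_mod_cast pieces_pos _
  have e2 : 2 * (pieces (n + 1) * (2 / pieces (n + 1 + 1))) = 4 * (1 / (n + 3 : ℝ)) ^ 2 := by
    rw [pieces_succ (n + 1)]
    push_cast
    field_simp
    ring
  rw [e2]

lemma tendsto_one_div_slope_pow_mul (k : ℕ) :
    Tendsto (fun n : ℕ => 1 / (slope n ^ 3 * ((n : ℝ) + 2) ^ (k + 1))) atTop (𝓝[>] 0) := by
  refine tendsto_nhdsWithin_iff.2 ⟨?_, Eventually.of_forall fun n => ?_⟩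
  · refine squeeze_zero (fun n => ?_) (fun n => ?_)
      (tendsto_one_div_add_atTop_nhds_zero_nat (𝕜 := ℝ))
    · have := slope_pos n
      positivity
    · have h0 : (0 : ℝ) ≤ n := n.cast_nonneg
      have h1 : (1 : ℝ) ≤ slope n ^ 3 :=
        one_le_pow₀ (by linarith [natCast_add_one_le_slope n])
      have h2 : (n : ℝ) + 2 ≤ (n + 2) ^ (k + 1) := le_self_pow₀ (by linarith) (by omega)
      gcongr
      nlinarith
  · have := slope_pos n
    rw [mem_Ioi]
    positivity

/-! ### The Stieltjes measure as distributional derivative -/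

/-- The measure whose distribution function is the continuous monotone function `f`. -/
noncomputable def stieltjes {f : ℝ → ℝ} (hf : Monotone f) (hc : Continuous f) : Measure ℝ :=
  StieltjesFunction.measure ⟨f, hf, fun _ => hc.continuousWithinAt⟩

section Stieltjes

variable {f : ℝ → ℝ} (hf : Monotone f) (hc : Continuous f)

lemma stieltjes_Ioo (a b : ℝ) : stieltjes hf hc (Ioo a b) = ENNReal.ofReal (f b - f a) := by
  rw [stieltjes, StieltjesFunction.measure_Ioo]
  congr 2
  exact (hc.continuousWithinAt (s := Iic b)).leftLim_eq

lemma stieltjes_singleton (a : ℝ) : stieltjes hf hc {a} = 0 := by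
  rw [stieltjes, StieltjesFunction.measure_singleton,
    show Function.leftLim (⟨f, hf, fun _ => hc.continuousWithinAt⟩ : StieltjesFunction ℝ) a = f a
      from (hc.continuousWithinAt (s := Iic a)).leftLim_eq]
  change ENNReal.ofReal (f a - f a) = 0
  simp

lemma tendsto_atBot_of_eq_zero {f : ℝ → ℝ} (h0 : ∀ x ≤ 0, f x = 0) : Tendsto f atBot (𝓝 0) :=
  tendsto_const_nhds.congr' (by
    filter_upwards [eventually_le_atBot 0] with x hx using (h0 x hx).symm)

lemma tendsto_atTop_of_eq_one {f : ℝ → ℝ} (h1 : ∀ x, 1 ≤ x → f x = 1) : Tendsto f atTop (𝓝 1) :=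
  tendsto_const_nhds.congr' (by
    filter_upwards [eventually_ge_atTop 1] with x hx using (h1 x hx).symm)

lemma isProbabilityMeasure_stieltjes (h0 : ∀ x ≤ 0, f x = 0) (h1 : ∀ x, 1 ≤ x → f x = 1) :
    IsProbabilityMeasure (stieltjes hf hc) :=
  StieltjesFunction.isProbabilityMeasure _ (tendsto_atBot_of_eq_zero h0)
    (tendsto_atTop_of_eq_one h1)

lemma stieltjes_Iio (h0 : ∀ x ≤ 0, f x = 0) (t : ℝ) :
    stieltjes hf hc (Iio t) = ENNReal.ofReal (f t) := by
  rw [stieltjes, StieltjesFunction.measure_Iio _ (tendsto_atBot_of_eq_zero h0), sub_zero]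
  congr 1
  exact (hc.continuousWithinAt (s := Iic t)).leftLim_eq

/-- Integration by parts against a compactly supported test function. -/
lemma integral_mul_deriv_eq (h0 : ∀ x ≤ 0, f x = 0) (h1 : ∀ x, 1 ≤ x → f x = 1)
    {Ω : Set ℝ} {φ : ℝ → ℝ} (hφ : IsTest Ω φ) :
    ∫ x in Ω, f x * deriv φ x = - ∫ x, φ x ∂(stieltjes hf hc) := by
  have hP := isProbabilityMeasure_stieltjes hf hc h0 h1
  set μ := stieltjes hf hc with hμ
  obtain ⟨hd, hcs, hsupp⟩ := hφ
  have hint : Integrable (deriv φ) :=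
    (hd.continuous_deriv le_rfl).integrable_of_hasCompactSupport hcs.deriv
  rw [setIntegral_eq_integral_of_forall_compl_eq_zero]
  · have hm : MeasurableSet {p : ℝ × ℝ | p.2 < p.1} :=
      measurableSet_lt measurable_snd measurable_fst
    -- Since `f t` is the measure of `Iio t`, the claim is Fubini for `deriv φ t` on `{x < t}`.
    set G : ℝ → ℝ → ℝ := fun t x => (Iio t).indicator (fun _ => deriv φ t) x with hG
    have hGi : Integrable (Function.uncurry G) (volume.prod μ) := by
      have := (hint.comp_fst μ).indicator hm
      refine this.congr (Eventually.of_forall fun p => ?_)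
      by_cases h : p.2 < p.1 <;> simp [hG, Function.uncurry, indicator, h]
    have swap := integral_integral_swap hGi
    have l : ∀ t, ∫ x, G t x ∂μ = f t * deriv φ t := fun t => by
      rw [hG, integral_indicator measurableSet_Iio, setIntegral_const, measureReal_def,
        stieltjes_Iio hf hc h0, ENNReal.toReal_ofReal, smul_eq_mul]
      rw [← h0 (min t 0) (min_le_right _ _)]
      exact hf (min_le_left _ _)
    have r : ∀ x, ∫ t, G t x = - φ x := fun x => by
      have e : (fun t => G t x) = (Ioi x).indicator (deriv φ) := by
        ext t
        by_cases h : x < t <;> simp [hG, indicator, h]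
      rw [e, integral_indicator measurableSet_Ioi, hcs.integral_Ioi_deriv_eq hd]
    simp only [l, r, integral_neg] at swap
    exact swap
  · intro x hx
    have : x ∉ tsupport (deriv φ) := fun h => hx (hsupp (tsupport_deriv_subset h))
    rw [image_eq_zero_of_notMem_tsupport this, mul_zero]

lemma stieltjes_compl_Ioo (h0 : ∀ x ≤ 0, f x = 0) (h1 : ∀ x, 1 ≤ x → f x = 1) :
    stieltjes hf hc (Ioo 0 1)ᶜ = 0 := by
  have := isProbabilityMeasure_stieltjes hf hc h0 h1
  rw [prob_compl_eq_zero_iff measurableSet_Ioo, stieltjes_Ioo, h0 0 le_rfl, h1 1 le_rfl]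
  simp

lemma totalVar_eq_one {f : ℝ → ℝ} (hf : Monotone f) (hc : Continuous f)
    (h0 : ∀ x ≤ 0, f x = 0) (h1 : ∀ x, 1 ≤ x → f x = 1) :
    totalVar f (Ioo 0 1) = 1 := by
  have hP := isProbabilityMeasure_stieltjes hf hc h0 h1
  set μ := stieltjes hf hc with hμ
  apply le_antisymm
  · refine iSup₂_le fun φ hφ => ?_
    rw [integral_mul_deriv_eq hf hc h0 h1 hφ.1, ← integral_neg, ENNReal.ofReal_le_one]
    have hi : Integrable φ μ := hφ.1.1.continuous.integrable_of_hasCompactSupport hφ.1.2.1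
    calc ∫ x, - φ x ∂μ ≤ ∫ _, (1 : ℝ) ∂μ :=
          integral_mono hi.neg (integrable_const 1) fun x => (neg_le_abs _).trans (hφ.2 x)
      _ = 1 := by simp
  · have key : ∀ᶠ s : ℝ in 𝓝[>] 0, ENNReal.ofReal (f (1 - s) - f s) ≤ totalVar f (Ioo 0 1) := by
      filter_upwards [Ioo_mem_nhdsGT (by norm_num : (0 : ℝ) < 1 / 2)] with s hs
      -- A bump equal to 1 on `[s, 1 - s]` and supported in `[s / 2, 1 - s / 2]`. Its negative is
      -- the test function, because integration by parts changes the sign.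
      let B : ContDiffBump (1 / 2 : ℝ) :=
        ⟨1 / 2 - s, 1 / 2 - s / 2, by linarith [hs.2], by linarith [hs.1]⟩
      have hcl : tsupport B ⊆ Ioo 0 1 := by
        rw [B.tsupport_eq, Real.closedBall_eq_Icc]
        intro x hx
        have h1 : (1 / 2 : ℝ) - (1 / 2 - s / 2) ≤ x := hx.1
        have h2 : x ≤ (1 / 2 : ℝ) + (1 / 2 - s / 2) := hx.2
        constructor <;> linarith [hs.1]
      have hneg : tsupport (fun x => - B x) = tsupport B := by
        unfold tsupport
        congr 1
        exact Function.support_neg _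
      have hφ : IsTest (Ioo 0 1) (fun x => - B x) ∧ ∀ x, |(fun x => - B x) x| ≤ 1 := by
        refine ⟨⟨B.contDiff.neg, ?_, hneg ▸ hcl⟩, fun x => ?_⟩
        · rw [HasCompactSupport, hneg]
          exact B.hasCompactSupport
        · change |-B x| ≤ 1
          rw [abs_neg, abs_of_nonneg B.nonneg]
          exact B.le_one
      refine le_trans ?_ (le_iSup₂ (f := fun (φ : ℝ → ℝ)
        (_ : IsTest (Ioo 0 1) φ ∧ ∀ x, |φ x| ≤ 1) =>
          ENNReal.ofReal (∫ x in Ioo 0 1, f x * deriv φ x)) _ hφ)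
      rw [integral_mul_deriv_eq hf hc h0 h1 hφ.1, integral_neg, neg_neg]
      apply ENNReal.ofReal_le_ofReal
      have hi : Integrable (fun x => B x) μ :=
        B.continuous.integrable_of_hasCompactSupport B.hasCompactSupport
      have hle : f s ≤ f (1 - s) := hf (by linarith [hs.2])
      calc f (1 - s) - f s = ∫ x, (Ioo s (1 - s)).indicator (fun _ => (1 : ℝ)) x ∂μ := by
            rw [integral_indicator measurableSet_Ioo, setIntegral_const, measureReal_def,
              stieltjes_Ioo, ENNReal.toReal_ofReal (by linarith), smul_eq_mul, mul_one]
        _ ≤ ∫ x, B x ∂μ := by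
            refine integral_mono ((integrable_const 1).indicator measurableSet_Ioo) hi fun x => ?_
            refine indicator_le' (g := B) (fun x hx => ?_) (fun x _ => B.nonneg) x
            refine (B.one_of_mem_closedBall ?_).ge
            rw [Real.closedBall_eq_Icc]
            change x ∈ Icc ((1 / 2 : ℝ) - (1 / 2 - s)) (1 / 2 + (1 / 2 - s))
            constructor <;> linarith [hx.1, hx.2]
    refine le_of_tendsto ?_ key
    have hcont : Continuous fun s => ENNReal.ofReal (f (1 - s) - f s) := ENNReal.continuous_ofReal.comp (by fun_prop)
    have := (hcont.tendsto 0).mono_left (nhdsWithin_le_nhds (s := Ioi 0))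
    simpa [h0 0 le_rfl, h1 1 le_rfl] using this

end Stieltjes

lemma toJordanDecomposition_toSignedMeasure (μ : Measure ℝ) [IsFiniteMeasure μ] :
    μ.toSignedMeasure.toJordanDecomposition =
      ⟨μ, 0, Measure.MutuallySingular.zero_right⟩ := by
  apply JordanDecomposition.toSignedMeasure_injective
  rw [SignedMeasure.toSignedMeasure_toJordanDecomposition, JordanDecomposition.toSignedMeasure]
  simp

lemma isPurelyCantorian_of_mutuallySingular {f : ℝ → ℝ} (hf : Monotone f) (hc : Continuous f)
    (h0 : ∀ x ≤ 0, f x = 0) (h1 : ∀ x, 1 ≤ x → f x = 1)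
    (hs : stieltjes hf hc ⟂ₘ volume) : IsPurelyCantorian f (Ioo 0 1) := by
  have hP := isProbabilityMeasure_stieltjes hf hc h0 h1
  refine ⟨(stieltjes hf hc).toSignedMeasure, ⟨fun s hm hd => ?_, fun φ hφ => ?_⟩, ?_, fun x => ?_⟩
  · rw [Measure.toSignedMeasure_apply_measurable hm, measureReal_def,
      measure_mono_null hd.subset_compl_right (stieltjes_compl_Ioo hf hc h0 h1),
      ENNReal.toReal_zero]
  · rw [integral_mul_deriv_eq hf hc h0 h1 hφ, signedIntegral,
      toJordanDecomposition_toSignedMeasure]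
    simp
  · rw [SignedMeasure.totalVariation, toJordanDecomposition_toSignedMeasure]
    simpa using hs
  · rw [Measure.toSignedMeasure_apply_measurable (measurableSet_singleton x), measureReal_def,
      stieltjes_singleton, ENNReal.toReal_zero]

/-! ### Singularity -/

/-- The measure lives on the intersection of the rise sets: off each closed rise set the limit is
locally constant. That intersection is Lebesgue null since the slopes tend to infinity. -/
lemma mutuallySingular_stieltjes_cantorLimit :
    stieltjes cantorLimit_mono cantorLimit_continuous ⟂ₘ volume := by
  choose a ha using exists_isStaircase_approx
  set R : ℕ → Set ℝ := fun n => riseSet (slope n) (pieces n) (a n) with hR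
  have hclosed : ∀ n, IsClosed (R n) := fun n =>
    isClosed_biUnion_finset fun _ _ => isClosed_Icc
  refine ⟨(⋂ n, R n)ᶜ, (MeasurableSet.iInter fun n => (hclosed n).measurableSet).compl, ?_, ?_⟩
  · rw [compl_iInter, measure_iUnion_null_iff]
    intro n
    refine measure_null_of_locally_null _ fun x hx => ?_
    obtain ⟨r, hr, hball⟩ := Metric.isOpen_iff.1 (hclosed n).isOpen_compl x hx
    refine ⟨Ioo (x - r) (x + r), mem_nhdsWithin_of_mem_nhds
      (Ioo_mem_nhds (by linarith) (by linarith)), ?_⟩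
    rw [Real.ball_eq_Ioo] at hball
    have heq : approx n (x - r) = approx n (x + r) := by
      by_contra hne
      obtain ⟨z, hzR, hz⟩ := (ha n).exists_mem_riseSet (pieces_pos n)
        (((ha n).mono (by linarith : x - r ≤ x + r)).lt_of_ne hne)
      exact hball hz hzR
    rw [stieltjes_Ioo, cantorLimit_eq heq, sub_self, ENNReal.ofReal_zero]
  · rw [compl_compl, ← nonpos_iff_eq_zero]
    have hlim : Tendsto (fun n : ℕ => ENNReal.ofReal (1 / ((n : ℝ) + 1))) atTop (𝓝 0) := by
      have := ENNReal.tendsto_ofReal (tendsto_one_div_add_atTop_nhds_zero_nat (𝕜 := ℝ))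
      rwa [ENNReal.ofReal_zero] at this
    refine ge_of_tendsto' hlim fun n => (measure_mono (iInter_subset R n)).trans ?_
    refine ((ha n).volume_riseSet_le (pieces_pos n)).trans (ENNReal.ofReal_le_ofReal ?_)
    have := natCast_add_one_le_slope n
    gcongr

/-! ### Lower and upper limits of `K` -/

lemma tendsto_one_div_natCast_add (k : ℝ) :
    Tendsto (fun n : ℕ => 1 / ((n : ℝ) + k)) atTop (𝓝 0) :=
  (tendsto_const_nhds (x := (1 : ℝ))).div_atTop
    (tendsto_atTop_add_const_right _ k tendsto_natCast_atTop_atTop)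

lemma liminf_K_cantorLimit :
    liminf (fun ε : ℝ => K ε cantorLimit (Ioo 0 1)) (𝓝[>] 0) = 1 / 4 := by
  have hq : ENNReal.ofReal (1 / 4) = 1 / 4 := by
    rw [ENNReal.ofReal_div_of_pos (by norm_num)]; simp
  apply le_antisymm
  · have hv := tendsto_one_div_slope_pow_mul 0
    simp only [zero_add, pow_one] at hv
    refine hv.liminf_le_liminf_comp.trans ?_
    have hlim : Tendsto (fun n : ℕ => ENNReal.ofReal
        ((1 / 4 + 4 * (1 / ((n : ℝ) + 2))) * (1 + 2 * (1 / (n + 2))))) atTop (𝓝 (1 / 4)) := by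
      have h := tendsto_one_div_natCast_add 2
      have := ENNReal.tendsto_ofReal
        (((h.const_mul 4).const_add (1 / 4)).mul ((h.const_mul 2).const_add 1))
      simpa only [mul_zero, add_zero, mul_one, hq] using this
    rw [← hlim.liminf_eq]
    exact liminf_le_liminf (Eventually.of_forall K_cantorLimit_le)
  · have hlim : Tendsto (fun ε : ℝ => ENNReal.ofReal ((cantorLimit (1 - ε) - cantorLimit ε) / 4))
        (𝓝[>] 0) (𝓝 (1 / 4)) := by
      have hcc := cantorLimit_continuous
      have hcont : Continuous fun ε : ℝ =>
          ENNReal.ofReal ((cantorLimit (1 - ε) - cantorLimit ε) / 4) :=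
        ENNReal.continuous_ofReal.comp (by fun_prop)
      have := (hcont.tendsto 0).mono_left (nhdsWithin_le_nhds (s := Ioi 0))
      simpa only [sub_zero, cantorLimit_of_one_le le_rfl, cantorLimit_of_nonpos le_rfl, hq]
        using this
    rw [← hlim.liminf_eq]
    refine liminf_le_liminf ?_
    filter_upwards [Ioo_mem_nhdsGT (by norm_num : (0 : ℝ) < 1 / 2)] with ε hε
    exact quarter_le_K cantorLimit_mono hε.1 hε.2

lemma limsup_K_cantorLimit :
    limsup (fun ε : ℝ => K ε cantorLimit (Ioo 0 1)) (𝓝[>] 0) = 1 / 2 := by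
  have hq : ENNReal.ofReal (1 / 2) = 1 / 2 := by
    rw [ENNReal.ofReal_div_of_pos (by norm_num)]; simp
  apply le_antisymm
  · have hP := isProbabilityMeasure_stieltjes cantorLimit_mono cantorLimit_continuous
      (fun _ => cantorLimit_of_nonpos) (fun _ => cantorLimit_of_one_le)
    refine limsup_le_of_le (by isBoundedDefault) ?_
    filter_upwards [self_mem_nhdsWithin] with ε hε
    exact K_le_half cantorLimit_mono _ (stieltjes_Ioo cantorLimit_mono cantorLimit_continuous)
      prob_le_one _ hε
  · refine le_trans ?_ (tendsto_one_div_slope_pow_mul 1).limsup_comp_le_limsup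
    have hlim : Tendsto (fun n : ℕ => ENNReal.ofReal
        ((1 - 1 / ((n : ℝ) + 2)) / 2 * (1 - 4 * (1 / (n + 3)) ^ 2))) atTop (𝓝 (1 / 2)) := by
      have h := tendsto_one_div_natCast_add 2
      have h' := tendsto_one_div_natCast_add 3
      have := ENNReal.tendsto_ofReal
        (((h.const_sub 1).div_const 2).mul (((h'.pow 2).const_mul 4).const_sub 1))
      simpa only [mul_zero, sub_zero, mul_one, hq, ne_eq, OfNat.ofNat_ne_zero, not_false_eq_true,
        zero_pow] using this
    rw [← hlim.limsup_eq]
    exact limsup_le_limsup (Eventually.of_forall le_K_cantorLimit)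

end OneDimBV

theorem lemmaB1 :
    ∃ u : ℝ → ℝ,
      OneDimBV.IsBV u (Ioo 0 1) ∧
      OneDimBV.IsPurelyCantorian u (Ioo 0 1) ∧
      MonotoneOn u (Ioo 0 1) ∧
      OneDimBV.totalVar u (Ioo 0 1) = 1 ∧
      liminf (fun ε : ℝ => OneDimBV.K ε u (Ioo 0 1)) (𝓝[>] 0) = 1 / 4 ∧
      limsup (fun ε : ℝ => OneDimBV.K ε u (Ioo 0 1)) (𝓝[>] 0) = 1 / 2 ∧
      ¬ ∃ L : ℝ≥0∞, Tendsto (fun ε : ℝ => OneDimBV.K ε u (Ioo 0 1)) (𝓝[>] 0) (𝓝 L) := by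
  have hvar := OneDimBV.totalVar_eq_one OneDimBV.cantorLimit_mono OneDimBV.cantorLimit_continuous
    (fun _ => OneDimBV.cantorLimit_of_nonpos) (fun _ => OneDimBV.cantorLimit_of_one_le)
  refine ⟨OneDimBV.cantorLimit, ⟨?_, ?_⟩, ?_, OneDimBV.cantorLimit_mono.monotoneOn _, hvar,
    OneDimBV.liminf_K_cantorLimit, OneDimBV.limsup_K_cantorLimit, ?_⟩
  · exact (OneDimBV.cantorLimit_continuous.integrableOn_Icc (a := 0) (b := 1)).mono_set
      Ioo_subset_Icc_self
  · rw [hvar]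
    exact ENNReal.one_lt_top
  · exact OneDimBV.isPurelyCantorian_of_mutuallySingular _ _
      (fun _ => OneDimBV.cantorLimit_of_nonpos) (fun _ => OneDimBV.cantorLimit_of_one_le)
      OneDimBV.mutuallySingular_stieltjes_cantorLimit
  · rintro ⟨L, hL⟩
    have h1 := hL.liminf_eq
    have h2 := hL.limsup_eq
    rw [OneDimBV.liminf_K_cantorLimit] at h1
    rw [OneDimBV.limsup_K_cantorLimit] at h2
    have h := congrArg ENNReal.toReal (h1.trans h2.symm)
    norm_num at h
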